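/- Consider the multinomial logit (MNL) bandit with items $1,\dots,N$, revenues $r_i\in[0,1]$, attraction parameters $0<v_i\le 1$ and $v_0=1$: when an assortment $S\subseteq\{1,\dots,N\}$ is offered, the customer chooses item $i\in S$ with probability $v_i/(1+\sum_{j\in S}v_j)$ and makes no purchase with probability $1/(1+\sum_{j\in S}v_j)$. Let $\mathcal S$ be a non-empty family of assortments closed under taking subsets, and put $R(S,w)=\frac{\sum_{i\in S}r_iw_i}{1+\sum_{j\in S}w_j}$ and $R(S)=R(S,v)$. Let $T\ge 1$ be an integer and $\alpha\in[0,\tfrac12]$, and put $\alpha_\ell=\frac1{2\ell^\alpha}$. The algorithm proceeds in epochs $\ell=1,2,\dots$. At the start of epoch $\ell$ it chooses $S_\ell^*\in\arg\max_{S\in\mathcal S}R(S,v^{UCB}_{\cdot,\ell-1})$ (with ties broken by any rule depending on the completed epochs) and then, independently, sets $S_\ell=\{1,\dots,N\}\setminus S_\ell^*$ with probability $\alpha_\ell$ and $S_\ell=S_\ell^*$ otherwise. It offers $S_\ell$ at successive time steps until the first no-purchase, which ends the epoch. Let $\hat v_{i,\ell}$ be the number of purchases of $i$ in epoch $\ell$,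 let $T_i(\ell)$ be the number of epochs $\ell'\le\ell$ with $i\in S_{\ell'}$, and let $\bar v_{i,\ell}$ be the mean of $\hat v_{i,\ell'}$ over these epochs. Then $$v^{UCB}_{i,\ell}=\bar v_{i,\ell}+\sqrt{\bar v_{i,\ell}\tfrac{48\log(\sqrt N\ell+1)}{T_i(\ell)}}+\tfrac{48\log(\sqrt N\ell+1)}{T_i(\ell)}$$ if $T_i(\ell)\ge1$, and $v^{UCB}_{i,\ell}=1$ if $T_i(\ell)=0$. Let $L$ be the least integer such that the first $L+1$ epochs have total length at least $T$, that is, the number of epochs completed before time $T$. Define $$\hat v_i=\frac1L\sum_{\ell=1}^{L}\frac{\hat v_{i,\ell}\,\mathbf 1(i\in S_\ell)}{P(i\in S_\ell\mid S_\ell^*)},$$ where $P(i\in S_\ell\mid S^*_\ell)$ is $1-\alpha_\ell$ if $i\in S_\ell^*$ and $\alpha_\ell$ otherwise ($\hat v_i=0$ if $L=0$), and $\hat R(S)=R(S,\hat v)$. Then for every $\delta\in(0,1)$, with probability at least $1-\delta$, simultaneously for all $S\in\mathcal S$, $$|\hat R(S)-R(S)|\le 12\sqrt2\,\ln\!\Big(\frac2\delta\Big)(2N^2+N)\sqrt{\Big(\frac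 NT\Big)^{1-\alpha}}.$$ Moreover, there is a constant $C$ depending only on $N$ such that $\mathbb E\,|\hat R(S)-R(S)|\le C\sqrt{T^{\alpha-1}}$ for all $S\in\mathcal S$ and all $v,r,\mathcal S,\alpha,T$ as above and all tie-breaking rules. -/

import Mathlib

open MeasureTheory
open scoped ENNReal

noncomputable section

namespace MNLBandit

/-! The multinomial logit (MNL) choice model with items `Fin N`, attraction parameters
`v : Fin N → ℝ`, no-purchase parameter `1`, and item revenues `r : Fin N → ℝ`. -/

/-- Unnormalised MNL weights for the offered assortment `S`; `none` is the no-purchase option. -/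
def choiceWeight {N : ℕ} (v : Fin N → ℝ) (S : Finset (Fin N)) : Option (Fin N) → ℝ≥0∞
  | none => 1
  | some i => if i ∈ S then ENNReal.ofReal (v i) else 0

theorem tsum_choiceWeight_ne_zero {N : ℕ} (v : Fin N → ℝ) (S : Finset (Fin N)) :
    ∑' c, choiceWeight v S c ≠ 0 := by
  intro h
  have h1 := ENNReal.tsum_eq_zero.mp h none
  simp [choiceWeight] at h1

theorem tsum_choiceWeight_ne_top {N : ℕ} (v : Fin N → ℝ) (S : Finset (Fin N)) :
    ∑' c, choiceWeight v S c ≠ ∞ := by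
  rw [tsum_fintype]
  refine ENNReal.sum_ne_top.mpr ?_
  rintro (_ | i) _
  · simp [choiceWeight]
  · by_cases h : i ∈ S <;> simp [choiceWeight, h]

/-- The law of the customer's choice when `S` is offered: item `i ∈ S` with probability
`v i / (1 + ∑ j ∈ S, v j)`, no purchase with probability `1 / (1 + ∑ j ∈ S, v j)`. -/
def choiceLaw {N : ℕ} (v : Fin N → ℝ) (S : Finset (Fin N)) : PMF (Option (Fin N)) :=
  PMF.normalize (choiceWeight v S) (tsum_choiceWeight_ne_zero v S) (tsum_choiceWeight_ne_top v S)

/-- Expected revenue of the assortment `S` under attraction parameters `w`. -/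
def revenue {N : ℕ} (r w : Fin N → ℝ) (S : Finset (Fin N)) : ℝ :=
  (∑ i ∈ S, r i * w i) / (1 + ∑ j ∈ S, w j)

/-- What is recorded about an epoch: the optimistic assortment `star`, the assortment `offered`
throughout the epoch (`star` or its complement), and for each item the number of times it was
chosen during the epoch. -/
structure Epoch (N : ℕ) where
  star : Finset (Fin N)
  offered : Finset (Fin N)
  count : Fin N → ℕ

/-- A history is the list of completed epochs, the most recent one first. -/
abbrev History (N : ℕ) := List (Epoch N)

/-- The exploration probability `1 / (2 ℓ ^ α)` of epoch `ℓ`. -/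
def exploreProb (α : ℝ) (l : ℕ) : ℝ := 1 / (2 * (l : ℝ) ^ α)

theorem exploreProb_mem {α : ℝ} (hα : 0 ≤ α) (l : ℕ) :
    0 ≤ exploreProb α (l + 1) ∧ exploreProb α (l + 1) ≤ 1 := by
  have h1 : (1 : ℝ) ≤ ((l + 1 : ℕ) : ℝ) ^ α :=
    Real.one_le_rpow (by push_cast; linarith [Nat.cast_nonneg (α := ℝ) l]) hα
  unfold exploreProb
  refine ⟨by positivity, ?_⟩
  rw [div_le_one (by linarith)]
  linarith

/-- The exploration coin of epoch `l + 1`: `true` with probability `exploreProb α (l + 1)`. -/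
def exploreCoin {α : ℝ} (hα : 0 ≤ α) (l : ℕ) : PMF Bool :=
  PMF.ofFintype
    (fun b => ENNReal.ofReal (if b then exploreProb α (l + 1) else 1 - exploreProb α (l + 1)))
    (by
      obtain ⟨h0, h1⟩ := exploreProb_mem hα l
      simp only [Fintype.sum_bool, if_true, Bool.false_eq_true, if_false]
      rw [← ENNReal.ofReal_add h0 (by linarith)]
      simp)

/-- `T_i(ℓ)`: the number of completed epochs in which item `i` was offered. -/
def timesOffered {N : ℕ} (h : History N) (i : Fin N) : ℕ :=
  (h.filter (fun e => i ∈ e.offered)).length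

/-- The sample mean of the epoch counts of item `i` over the epochs in which it was offered. -/
def sampleMean {N : ℕ} (h : History N) (i : Fin N) : ℝ :=
  ((h.filter (fun e => i ∈ e.offered)).map (fun e => (e.count i : ℝ))).sum / timesOffered h i

/-- The upper confidence bound of item `i` after the `ℓ = h.length` epochs of `h`. An item that was
never offered keeps the initial value `1`. -/
def ucb {N : ℕ} (h : History N) (i : Fin N) : ℝ :=
  if timesOffered h i = 0 then 1
  else
    sampleMean h i
      + √(sampleMean h i * (48 * Real.log (√(N : ℝ) * h.length + 1) / timesOffered h i))
      + 48 * Real.log (√(N : ℝ) * h.length + 1) / timesOffered h i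

/-- `rule` selects, after every history, an assortment in `𝒮` that maximises the optimistic revenue
`revenue r (ucb h)`; ties are broken arbitrarily. -/
def IsOptimistic {N : ℕ} (r : Fin N → ℝ) (𝒮 : Finset (Finset (Fin N)))
    (rule : History N → Finset (Fin N)) : Prop :=
  ∀ h, rule h ∈ 𝒮 ∧ ∀ S ∈ 𝒮, revenue r (ucb h) S ≤ revenue r (ucb h) (rule h)

/-- State of the algorithm: the completed epochs and the current epoch (its counts so far). -/
structure State (N : ℕ) where
  done : History N
  current : Epoch N

instance (N : ℕ) : MeasurableSpace (State N) := ⊤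

/-- Start epoch `ℓ = h.length + 1` after the completed epochs `h`: the assortment offered is the
complement of the optimistic one with probability `1 / (2 ℓ ^ α)`, else the optimistic one. -/
def startEpoch {N : ℕ} {α : ℝ} (hα : 0 ≤ α) (rule : History N → Finset (Fin N))
    (h : History N) : PMF (State N) :=
  (exploreCoin hα h.length).map
    fun explore =>
      ⟨h, rule h, if explore then (rule h)ᶜ else rule h, fun _ => 0⟩

/-- One time step: offer the assortment of the current epoch and observe the customer's choice.
A purchase is counted; a no-purchase ends the epoch and starts the next one. -/
def step {N : ℕ} (v : Fin N → ℝ) {α : ℝ} (hα : 0 ≤ α) (rule : History N → Finset (Fin N))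
    (s : State N) : PMF (State N) :=
  (choiceLaw v s.current.offered).bind fun c =>
    match c with
    | none => startEpoch hα rule (s.current :: s.done)
    | some i => PMF.pure
        ⟨s.done, s.current.star, s.current.offered,
          Function.update s.current.count i (s.current.count i + 1)⟩

/-- Law of the state after `n` time steps. -/
def runLaw {N : ℕ} (v : Fin N → ℝ) {α : ℝ} (hα : 0 ≤ α) (rule : History N → Finset (Fin N)) :
    ℕ → PMF (State N)
  | 0 => startEpoch hα rule []
  | n + 1 => (runLaw v hα rule n).bind (step v hα rule)

/-- Law of the state on termination with horizon `T`: time starts at `t = 1` and steps are made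
while `t < T`. Hence the completed epochs in the final state are those whose total length is less
than `T`, that is, their number is the least `L` such that the first `L + 1` epochs have total
length at least `T`. -/
def outcome {N : ℕ} (v : Fin N → ℝ) {α : ℝ} (hα : 0 ≤ α) (rule : History N → Finset (Fin N))
    (T : ℕ) : Measure (State N) :=
  (runLaw v hα rule (T - 1)).toMeasure

/-- Conditional probability, given the optimistic assortment `star` of epoch `l`, that item `i` is
in the assortment offered in epoch `l`. -/
def inclusionProb {N : ℕ} (α : ℝ) (l : ℕ) (star : Finset (Fin N)) (i : Fin N) : ℝ :=
  if i ∈ star then 1 - exploreProb α l else exploreProb α l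

/-- The inverse-probability weighted cumulative estimator `SumV_ℓ(i)`. -/
def sumV {N : ℕ} (α : ℝ) : History N → Fin N → ℝ
  | [], _ => 0
  | e :: h, i => sumV α h i +
      if i ∈ e.offered then (e.count i : ℝ) / inclusionProb α (h.length + 1) e.star i else 0

/-- The estimator `SumV_L(i) / L` of the attraction parameter of item `i`, where `L` is the number
of completed epochs (the value is `0` if no epoch was completed). -/
def vHat {N : ℕ} (α : ℝ) (s : State N) (i : Fin N) : ℝ :=
  sumV α s.done i / s.done.length

/-- The plug-in estimator of the expected revenue of `S`. -/
def revenueHat {N : ℕ} (r : Fin N → ℝ) (α : ℝ) (s : State N) (S : Finset (Fin N)) : ℝ :=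
  revenue r (vHat α s) S

end MNLBandit

end

/-!
The error of the plug-in revenue is at most `∑ i, |v̂ i - v i|` and at most `1`, because `R(S, ·)`
is `1`-Lipschitz in each attraction parameter and takes values in `[0, 1]`
(`abs_revenue_sub_le_sum`, `abs_revenue_sub_le_one`). So it suffices to control each inverse
probability weighted mean `v̂ i`, and only when the claimed bound is below `1`, which forces `T` to
be large.

Within an epoch that offers `i`, the number of purchases of `i` is geometric with mean `v i`, for
every assortment and whatever happened before. Weighted by the inverse of the inclusion probability
`p ≥ 1 / (2 T ^ α)`, its centred exponential moment at a small exponent `lam` is at most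
`exp (O(lam ^ 2 / p))` (`weighted_geometric_mgf_le`). Hence
`exp (lam (sumV - v L) - κ L)` with `κ = 9 lam ^ 2 T ^ α`, times the conditional expectation of the
contribution of the running epoch, is a supermartingale for the chain of time steps. The horizon is
a fixed time in the middle of an epoch, and the contribution of this epoch can be small. Since an
epoch ends at each step with probability at least `1 / (N + 1)`, removing that contribution costs
only a factor `N + 1` in expectation (`mean_runLaw_expDev_le`).
As the exponent `lam` is fixed, this single bound serves all values of the random number `L` of
completed epochs; no union over `L` and no stopping argument is needed.

For the same reason `L ≥ T / (3 (N + 1))` outside an event of small probability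
(`mean_runLaw_half_pow_le`). With `x = √(T ^ (α - 1))`, the choice `lam = (N + 1) x / T ^ α` gives
`|v̂ i - v i| ≤ κ / lam + (2 N + 1) log (2 / δ) / (lam L) = O((N + 1) log (2 / δ) x)` for all `i`
simultaneously (`toMeasure_deviation_le`). The bound in expectation is the integral of the
resulting exponential tail.
-/

namespace MNLBandit

open Real

/-! ### Sensitivity of the expected revenue to the attraction parameters -/

theorem revenue_mem_Icc {N : ℕ} {r w : Fin N → ℝ} (hr : ∀ i, 0 ≤ r i ∧ r i ≤ 1)
    (hw : ∀ i, 0 ≤ w i) (S : Finset (Fin N)) : 0 ≤ revenue r w S ∧ revenue r w S ≤ 1 := by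
  have hW : 0 ≤ ∑ j ∈ S, w j := Finset.sum_nonneg fun i _ => hw i
  refine ⟨div_nonneg (Finset.sum_nonneg fun i _ => mul_nonneg (hr i).1 (hw i)) (by linarith), ?_⟩
  unfold revenue
  rw [div_le_one (by linarith)]
  have : ∑ i ∈ S, r i * w i ≤ ∑ i ∈ S, w i :=
    Finset.sum_le_sum fun i _ => mul_le_of_le_one_left (hw i) (hr i).2
  linarith

theorem abs_revenue_sub_le_one {N : ℕ} {r w v : Fin N → ℝ} (hr : ∀ i, 0 ≤ r i ∧ r i ≤ 1)
    (hw : ∀ i, 0 ≤ w i) (hv : ∀ i, 0 ≤ v i) (S : Finset (Fin N)) :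
    |revenue r w S - revenue r v S| ≤ 1 := by
  have h1 := revenue_mem_Icc hr hw S
  have h2 := revenue_mem_Icc hr hv S
  rw [abs_le]
  constructor <;> linarith

/-- The difference of revenues equals `∑ i ∈ S, (r i - R(S, v)) (w i - v i) / (1 + ∑ j ∈ S, w j)`,
in which every coefficient of `w i - v i` has absolute value at most `1`. -/
theorem abs_revenue_sub_le_sum {N : ℕ} {r w v : Fin N → ℝ} (hr : ∀ i, 0 ≤ r i ∧ r i ≤ 1)
    (hw : ∀ i, 0 ≤ w i) (hv : ∀ i, 0 ≤ v i) (S : Finset (Fin N)) :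
    |revenue r w S - revenue r v S| ≤ ∑ i ∈ S, |w i - v i| := by
  have hW : 0 ≤ ∑ j ∈ S, w j := Finset.sum_nonneg fun i _ => hw i
  have hV : 0 ≤ ∑ j ∈ S, v j := Finset.sum_nonneg fun i _ => hv i
  have hR := revenue_mem_Icc hr hv S
  have key : revenue r w S - revenue r v S
      = (∑ i ∈ S, (r i - revenue r v S) * (w i - v i)) / (1 + ∑ j ∈ S, w j) := by
    have hRv : revenue r v S * (1 + ∑ j ∈ S, v j) = ∑ i ∈ S, r i * v i :=
      div_mul_cancel₀ _ (by linarith)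
    have hexp : ∑ i ∈ S, (r i - revenue r v S) * (w i - v i)
        = ∑ i ∈ S, r i * w i - ∑ i ∈ S, r i * v i
          - revenue r v S * (∑ i ∈ S, w i - ∑ i ∈ S, v i) := by
      rw [← Finset.sum_sub_distrib, ← Finset.sum_sub_distrib, Finset.mul_sum,
        ← Finset.sum_sub_distrib]
      exact Finset.sum_congr rfl fun i _ => by ring
    rw [eq_div_iff (by linarith), hexp, ← hRv, sub_mul]
    have : revenue r w S * (1 + ∑ j ∈ S, w j) = ∑ i ∈ S, r i * w i :=
      div_mul_cancel₀ _ (by linarith)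
    rw [this]
    ring
  rw [key, abs_div, abs_of_nonneg (by linarith : 0 ≤ 1 + ∑ j ∈ S, w j)]
  refine (div_le_self (abs_nonneg _) (by linarith)).trans
    ((Finset.abs_sum_le_sum_abs _ _).trans (Finset.sum_le_sum fun i _ => ?_))
  rw [abs_mul]
  refine mul_le_of_le_one_left (abs_nonneg _) ?_
  have := hr i
  rw [abs_le]
  constructor <;> linarith

/-! ### Expectations under a probability mass function -/

/-- The expectation of the nonnegative function `f` under the discrete law `p`. -/
noncomputable def mean {β : Type*} (p : PMF β) (f : β → ℝ≥0∞) : ℝ≥0∞ := ∑' b, p b * f b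

theorem mean_pure {β : Type*} (b : β) (f : β → ℝ≥0∞) : mean (PMF.pure b) f = f b := by
  unfold mean
  rw [tsum_eq_single b]
  · simp
  · intro c hc
    simp [PMF.pure_apply, hc]

theorem mean_bind {β γ : Type*} (p : PMF β) (q : β → PMF γ) (f : γ → ℝ≥0∞) :
    mean (p.bind q) f = mean p fun b => mean (q b) f := by
  simp only [mean, PMF.bind_apply, ← ENNReal.tsum_mul_right, ← ENNReal.tsum_mul_left]
  rw [ENNReal.tsum_comm]
  simp only [mul_assoc]

theorem mean_map {β γ : Type*} (p : PMF β) (g : β → γ) (f : γ → ℝ≥0∞) :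
    mean (p.map g) f = mean p (f ∘ g) := by
  rw [← PMF.bind_pure_comp, mean_bind]
  simp only [Function.comp_apply, mean_pure]
  rfl

theorem mean_add {β : Type*} (p : PMF β) (f g : β → ℝ≥0∞) :
    mean p (fun b => f b + g b) = mean p f + mean p g := by
  simp only [mean, mul_add, ENNReal.tsum_add]

theorem mean_const_mul {β : Type*} (p : PMF β) (c : ℝ≥0∞) (f : β → ℝ≥0∞) :
    mean p (fun b => c * f b) = c * mean p f := by
  simp only [mean, ← ENNReal.tsum_mul_left]
  exact tsum_congr fun b => by ring

theorem mean_finset_sum {β ι : Type*} (p : PMF β) (s : Finset ι) (f : ι → β → ℝ≥0∞) :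
    mean p (fun b => ∑ i ∈ s, f i b) = ∑ i ∈ s, mean p (f i) := by
  simp only [mean, Finset.mul_sum]
  exact Summable.tsum_finsetSum fun i _ => ENNReal.summable

theorem mean_le_mean {β : Type*} {p : PMF β} {f g : β → ℝ≥0∞} (h : ∀ b ∈ p.support, f b ≤ g b) :
    mean p f ≤ mean p g := by
  refine ENNReal.tsum_le_tsum fun b => ?_
  by_cases hb : b ∈ p.support
  · exact mul_le_mul_right (h b hb) _
  · simp [(PMF.apply_eq_zero_iff p b).2 hb]

/-- Markov's inequality at level `1`. -/
theorem toMeasure_one_le_le_mean {N : ℕ} (p : PMF (State N)) (f : State N → ℝ≥0∞) :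
    p.toMeasure {s | 1 ≤ f s} ≤ mean p f := by
  rw [PMF.toMeasure_apply _ (MeasurableSpace.measurableSet_top)]
  refine ENNReal.tsum_le_tsum fun s => ?_
  by_cases hs : 1 ≤ f s
  · rw [Set.indicator_of_mem (by exact hs)]
    exact le_mul_of_one_le_right' hs
  · rw [Set.indicator_of_notMem (by exact hs)]
    exact zero_le

/-! ### One step of the process -/

theorem choiceWeight_tsum {N : ℕ} {v : Fin N → ℝ} (hv : ∀ i, 0 ≤ v i) (S : Finset (Fin N)) :
    ∑' c, choiceWeight v S c = ENNReal.ofReal (1 + ∑ j ∈ S, v j) := by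
  rw [tsum_fintype, Fintype.sum_option, ENNReal.ofReal_add zero_le_one
    (Finset.sum_nonneg fun i _ => hv i), ENNReal.ofReal_sum_of_nonneg fun i _ => hv i]
  simp [choiceWeight, Finset.sum_ite_mem]

theorem choiceLaw_none {N : ℕ} {v : Fin N → ℝ} (hv : ∀ i, 0 ≤ v i) (S : Finset (Fin N)) :
    choiceLaw v S none = ENNReal.ofReal (1 / (1 + ∑ j ∈ S, v j)) := by
  have hV : 0 ≤ ∑ j ∈ S, v j := Finset.sum_nonneg fun i _ => hv i
  rw [choiceLaw, PMF.normalize_apply, choiceWeight_tsum hv,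
    ← ENNReal.ofReal_inv_of_pos (by linarith)]
  simp [choiceWeight]

theorem choiceLaw_some {N : ℕ} {v : Fin N → ℝ} (hv : ∀ i, 0 ≤ v i) (S : Finset (Fin N))
    (i : Fin N) : choiceLaw v S (some i)
      = if i ∈ S then ENNReal.ofReal (v i / (1 + ∑ j ∈ S, v j)) else 0 := by
  have hV : 0 ≤ ∑ j ∈ S, v j := Finset.sum_nonneg fun i _ => hv i
  rw [choiceLaw, PMF.normalize_apply, choiceWeight_tsum hv,
    ← ENNReal.ofReal_inv_of_pos (by linarith)]
  by_cases hi : i ∈ S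
  · simp only [choiceWeight, hi, if_true]
    rw [← ENNReal.ofReal_mul (hv i), div_eq_mul_inv]
  · simp [choiceWeight, hi]

/-- The state reached from `s` when the customer buys item `i`. -/
def purchase {N : ℕ} (s : State N) (i : Fin N) : State N :=
  ⟨s.done, s.current.star, s.current.offered,
    Function.update s.current.count i (s.current.count i + 1)⟩

/-- Expectation after one step, in real terms: `a` bounds the expectation after a no-purchase and
`b i` the value after a purchase of `i`. -/
theorem mean_step_le {N : ℕ} {v : Fin N → ℝ} (hv : ∀ i, 0 ≤ v i) {α : ℝ} (hα : 0 ≤ α)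
    (rule : History N → Finset (Fin N)) (s : State N) {f : State N → ℝ≥0∞} {a : ℝ} {b : Fin N → ℝ}
    (ha0 : 0 ≤ a) (hb0 : ∀ i, 0 ≤ b i)
    (ha : mean (startEpoch hα rule (s.current :: s.done)) f ≤ ENNReal.ofReal a)
    (hb : ∀ i, f (purchase s i) ≤ ENNReal.ofReal (b i)) :
    mean (step v hα rule s) f ≤ ENNReal.ofReal
      ((a + ∑ i ∈ s.current.offered, v i * b i) / (1 + ∑ i ∈ s.current.offered, v i)) := by
  have hV : 0 ≤ ∑ j ∈ s.current.offered, v j := Finset.sum_nonneg fun i _ => hv i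
  have hsplit : (a + ∑ i ∈ s.current.offered, v i * b i) / (1 + ∑ i ∈ s.current.offered, v i)
      = 1 / (1 + ∑ i ∈ s.current.offered, v i) * a
        + ∑ i ∈ s.current.offered, v i / (1 + ∑ i ∈ s.current.offered, v i) * b i := by
    rw [add_div, Finset.sum_div]
    congr 1
    · ring
    · exact Finset.sum_congr rfl fun i _ => by ring
  have hterm : ∀ i, 0 ≤ v i / (1 + ∑ i ∈ s.current.offered, v i) * b i := fun i =>
    mul_nonneg (div_nonneg (hv i) (by linarith)) (hb0 i)
  rw [hsplit, ENNReal.ofReal_add (mul_nonneg (by positivity) ha0)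
    (Finset.sum_nonneg fun i _ => hterm i), ENNReal.ofReal_sum_of_nonneg fun i _ => hterm i,
    step, mean_bind, mean, tsum_fintype, Fintype.sum_option]
  refine add_le_add ?_ ?_
  · rw [choiceLaw_none hv, ENNReal.ofReal_mul (by positivity)]
    exact mul_le_mul_right ha _
  · rw [← Finset.sum_subset (Finset.subset_univ s.current.offered)]
    · refine Finset.sum_le_sum fun i hi => ?_
      rw [choiceLaw_some hv, if_pos hi, ENNReal.ofReal_mul (div_nonneg (hv i) (by linarith)),
        mean_pure]
      exact mul_le_mul_right (hb i) _
    · intro i _ hi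
      rw [choiceLaw_some hv, if_neg hi, zero_mul]

/-- Epoch numbers are bounded by the elapsed time. -/
theorem length_done_le_of_mem_support {N : ℕ} {v : Fin N → ℝ} {α : ℝ} (hα : 0 ≤ α)
    (rule : History N → Finset (Fin N)) (n : ℕ) :
    ∀ s ∈ (runLaw v hα rule n).support, s.done.length ≤ n := by
  have hstart : ∀ h, ∀ s ∈ (startEpoch hα rule h).support, s.done = h := by
    intro h s hs
    obtain ⟨b, -, rfl⟩ := (PMF.mem_support_map_iff _ _ _).1 hs
    rfl
  induction n with
  | zero =>
    intro s hs
    rw [hstart [] s hs]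
    rfl
  | succ n ih =>
    intro s hs
    obtain ⟨s', hs', hs⟩ := (PMF.mem_support_bind_iff _ _ _).1 hs
    obtain ⟨c, -, hs⟩ := (PMF.mem_support_bind_iff _ _ _).1 hs
    have := ih s' hs'
    rcases c with _ | i
    · rw [hstart _ s hs]
      simpa using this
    · rw [(PMF.mem_support_pure_iff _ _).1 hs]
      exact this.trans (Nat.le_succ n)

/-! ### Exponential moments of the weighted epoch counts -/

/-- A geometric number of purchases with mean `v` has moment generating function
`1 / (1 - v (exp μ - 1))`. Observed with probability `p` and then weighted by `1 / p`, its
moment generating function at `p μ` exceeds that of its mean by a factor `exp (O(p μ ^ 2))`. -/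
theorem weighted_geometric_mgf_le {p v μ : ℝ} (hp : 0 ≤ p) (hv0 : 0 ≤ v) (hv1 : v ≤ 1)
    (hμ : |μ| ≤ 1 / 4) :
    0 < 1 - v * (exp μ - 1) ∧
      1 - p + p / (1 - v * (exp μ - 1)) ≤ exp (p * μ * v + 9 / 2 * (p * μ ^ 2)) := by
  have hexp := abs_le.1 (abs_exp_sub_one_sub_id_le (hμ.trans (by norm_num)))
  obtain ⟨hμ1, hμ2⟩ := abs_le.1 hμ
  set u := v * (exp μ - 1) with hu
  have hμabs : |exp μ - 1| ≤ 5 / 4 * |μ| := by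
    have hsq : μ ^ 2 ≤ 1 / 4 * |μ| := by
      rw [← sq_abs]
      nlinarith [abs_nonneg μ]
    rw [abs_le]
    constructor <;> linarith [neg_abs_le μ, le_abs_self μ]
  have hu_abs : |u| ≤ 5 / 4 * |μ| := by
    rw [hu, abs_mul, abs_of_nonneg hv0]
    exact (mul_le_of_le_one_left (abs_nonneg _) hv1).trans hμabs
  have hu_small : u ≤ 5 / 16 := by linarith [le_abs_self u]
  have hu_sq : u ^ 2 ≤ 25 / 16 * μ ^ 2 := by
    rw [← sq_abs u, ← sq_abs μ]
    nlinarith [abs_nonneg u, abs_nonneg μ]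
  have hu_lin : u ≤ v * μ + μ ^ 2 := by
    have : u ≤ v * (μ + μ ^ 2) := mul_le_mul_of_nonneg_left (by linarith) hv0
    nlinarith [sq_nonneg μ]
  have hpos : 0 < 1 - u := by linarith
  refine ⟨hpos, ?_⟩
  have hinv : 1 / (1 - u) ≤ 1 + u + 2 * u ^ 2 := by
    rw [div_le_iff₀ hpos]
    nlinarith [sq_nonneg u, mul_nonneg (sq_nonneg u) (by linarith : 0 ≤ 5 / 16 - u)]
  calc 1 - p + p / (1 - u) = 1 - p + p * (1 / (1 - u)) := by ring
    _ ≤ 1 - p + p * (1 + (v * μ + μ ^ 2) + 25 / 8 * μ ^ 2) := by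
        gcongr
        linarith
    _ ≤ p * μ * v + 9 / 2 * (p * μ ^ 2) + 1 := by nlinarith [mul_nonneg hp (sq_nonneg μ)]
    _ ≤ _ := add_one_le_exp _

/-! ### The exponential supermartingale -/

/-- The exponential of `lam` times the deviation of `sumV` from its compensator, with the penalty
`κ` per epoch, evaluated on the completed epochs. -/
noncomputable def expDev {N : ℕ} (v : Fin N → ℝ) (α : ℝ) (i : Fin N) (lam κ : ℝ)
    (h : History N) : ℝ :=
  exp (lam * (sumV α h i - v i * h.length) - κ * h.length)

/-- The conditional expectation, given the state `e` of the running epoch number `l`, of the factor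
by which this epoch multiplies `expDev`. -/
noncomputable def epochFactor {N : ℕ} (v : Fin N → ℝ) (α : ℝ) (i : Fin N) (lam κ : ℝ) (l : ℕ)
    (e : Epoch N) : ℝ :=
  exp (-lam * v i - κ) *
    if i ∈ e.offered then
      exp (lam / inclusionProb α l e.star i * e.count i)
        / (1 - v i * (exp (lam / inclusionProb α l e.star i) - 1))
    else 1

/-- The exponent `lam` is small enough, and the penalty `κ` large enough, for epoch `l`. -/
def Admissible {N : ℕ} (α : ℝ) (i : Fin N) (lam κ : ℝ) (l : ℕ) : Prop :=
  ∀ star : Finset (Fin N), 0 < inclusionProb α l star i ∧ inclusionProb α l star i ≤ 1 ∧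
    |lam / inclusionProb α l star i| ≤ 1 / 4 ∧
    9 / 2 * (lam ^ 2 / inclusionProb α l star i) ≤ κ

section Supermartingale

variable {N : ℕ} {v : Fin N → ℝ} {α : ℝ} {i : Fin N} {lam κ : ℝ}

theorem expDev_pos (h : History N) : 0 < expDev v α i lam κ h := exp_pos _

theorem expDev_cons (e : Epoch N) (h : History N) :
    expDev v α i lam κ (e :: h) = expDev v α i lam κ h * (exp (-lam * v i - κ) *
      if i ∈ e.offered then
        exp (lam / inclusionProb α (h.length + 1) e.star i * e.count i) else 1) := by
  by_cases hi : i ∈ e.offered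
  · simp only [expDev, sumV, hi, if_true, List.length_cons, ← exp_add]
    congr 1
    push_cast
    ring
  · simp only [expDev, sumV, hi, if_false, List.length_cons, ← exp_add, mul_one]
    congr 1
    push_cast
    ring

theorem epochFactor_nonneg (hv : ∀ i, 0 < v i ∧ v i ≤ 1) {l : ℕ}
    (hadm : Admissible α i lam κ l) (e : Epoch N) : 0 ≤ epochFactor v α i lam κ l e := by
  have hpos := (weighted_geometric_mgf_le zero_le_one (hv i).1.le (hv i).2 (hadm e.star).2.2.1).1
  unfold epochFactor
  split_ifs
  · positivity
  · positivity

/-- Averaged over the exploration coin, a fresh epoch does not increase `expDev`. -/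
theorem mean_startEpoch_le (hv : ∀ i, 0 < v i ∧ v i ≤ 1) (hα : 0 ≤ α)
    (rule : History N → Finset (Fin N)) (h : History N)
    (hadm : Admissible α i lam κ (h.length + 1)) :
    mean (startEpoch hα rule h) (fun s => ENNReal.ofReal (expDev v α i lam κ s.done *
        epochFactor v α i lam κ (s.done.length + 1) s.current))
      ≤ ENNReal.ofReal (expDev v α i lam κ h) := by
  obtain ⟨hp0, hp1, hμ, hκ⟩ := hadm (rule h)
  obtain ⟨hc0, hc1⟩ := exploreProb_mem hα h.length
  have hA := expDev_pos (v := v) (α := α) (i := i) (lam := lam) (κ := κ) h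
  have hmgf := weighted_geometric_mgf_le hp0.le (hv i).1.le (hv i).2 hμ
  set p := inclusionProb α (h.length + 1) (rule h) i with hp
  have hbound : exp (-lam * v i - κ) * (1 - p + p / (1 - v i * (exp (lam / p) - 1))) ≤ 1 := by
    refine (mul_le_mul_of_nonneg_left hmgf.2 (exp_pos _).le).trans ?_
    rw [← exp_add, exp_le_one_iff]
    have h1 : p * (lam / p) = lam := by field_simp
    have h2 : p * (lam / p) ^ 2 = lam ^ 2 / p := by field_simp
    rw [h1, h2]
    linarith
  have hval : ∀ S, 0 ≤ expDev v α i lam κ h * epochFactor v α i lam κ (h.length + 1)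
      ⟨rule h, S, fun _ => 0⟩ := fun S =>
    mul_nonneg hA.le (epochFactor_nonneg hv hadm _)
  rw [startEpoch, mean_map, mean, tsum_fintype, Fintype.sum_bool]
  simp only [Function.comp_apply, exploreCoin, PMF.ofFintype_apply, if_true, Bool.false_eq_true,
    if_false]
  rw [← ENNReal.ofReal_mul hc0, ← ENNReal.ofReal_mul (sub_nonneg.2 hc1),
    ← ENNReal.ofReal_add (mul_nonneg hc0 (hval _)) (mul_nonneg (sub_nonneg.2 hc1) (hval _))]
  refine ENNReal.ofReal_le_ofReal ?_
  refine le_trans (le_of_eq ?_) (mul_le_of_le_one_right hA.le hbound)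
  by_cases hi : i ∈ rule h
  · have hpe : exploreProb α (h.length + 1) = 1 - p := by simp [hp, inclusionProb, hi]
    simp [epochFactor, hi, ← hp, hpe]
    ring
  · have hpe : exploreProb α (h.length + 1) = p := by simp [hp, inclusionProb, hi]
    simp [epochFactor, hi, ← hp, hpe]
    ring

theorem epochFactor_update (e : Epoch N) (l : ℕ) (j : Fin N) :
    epochFactor v α i lam κ l ⟨e.star, e.offered, Function.update e.count j (e.count j + 1)⟩
      = epochFactor v α i lam κ l e *
        if j = i ∧ i ∈ e.offered then exp (lam / inclusionProb α l e.star i) else 1 := by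
  by_cases hi : i ∈ e.offered
  · by_cases hj : j = i
    · subst hj
      simp only [epochFactor, hi, if_true, Function.update_self, and_self]
      push_cast
      rw [mul_add, mul_one, exp_add]
      ring
    · have : i ≠ j := fun h => hj h.symm
      simp [epochFactor, hi, hj, Function.update_of_ne this]
  · simp [epochFactor, hi]

/-- Conditioning the factor of the running epoch on the next choice: the memoryless property of the
geometric law. -/
theorem epochFactor_step (hv : ∀ i, 0 < v i ∧ v i ≤ 1) (h : History N) (e : Epoch N)
    (hadm : Admissible α i lam κ (h.length + 1)) :
    expDev v α i lam κ (e :: h) + ∑ j ∈ e.offered, v j * (expDev v α i lam κ h *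
        epochFactor v α i lam κ (h.length + 1)
          ⟨e.star, e.offered, Function.update e.count j (e.count j + 1)⟩)
      = (1 + ∑ j ∈ e.offered, v j) *
        (expDev v α i lam κ h * epochFactor v α i lam κ (h.length + 1) e) := by
  have hpos := (weighted_geometric_mgf_le zero_le_one (hv i).1.le (hv i).2 (hadm e.star).2.2.1).1
  simp only [epochFactor_update, expDev_cons]
  by_cases hi : i ∈ e.offered
  · have hsum : ∑ j ∈ e.offered, v j *
          (if j = i ∧ i ∈ e.offered then
            exp (lam / inclusionProb α (h.length + 1) e.star i) else 1)
        = ∑ j ∈ e.offered, v j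
          + v i * (exp (lam / inclusionProb α (h.length + 1) e.star i) - 1) := by
      rw [← Finset.add_sum_erase _ _ hi, ← Finset.add_sum_erase _ v hi]
      simp only [hi, and_true, if_true]
      rw [Finset.sum_congr rfl fun j hj => by rw [if_neg (Finset.ne_of_mem_erase hj), mul_one]]
      ring
    have hfac : ∑ j ∈ e.offered, v j * (expDev v α i lam κ h *
          (epochFactor v α i lam κ (h.length + 1) e *
            if j = i ∧ i ∈ e.offered then
              exp (lam / inclusionProb α (h.length + 1) e.star i) else 1))
        = expDev v α i lam κ h * epochFactor v α i lam κ (h.length + 1) e *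
          ∑ j ∈ e.offered, v j * (if j = i ∧ i ∈ e.offered then
            exp (lam / inclusionProb α (h.length + 1) e.star i) else 1) := by
      rw [Finset.mul_sum]
      exact Finset.sum_congr rfl fun j _ => by ring
    rw [hfac, hsum]
    simp only [epochFactor, hi, if_true]
    field_simp
    ring
  · simp only [epochFactor, hi, and_false, if_false, ← Finset.sum_mul]
    ring

theorem mean_step_supermartingale_le (hv : ∀ i, 0 < v i ∧ v i ≤ 1) (hα : 0 ≤ α)
    (rule : History N → Finset (Fin N)) (s : State N)
    (hadm : Admissible α i lam κ (s.done.length + 1))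
    (hadm' : Admissible α i lam κ (s.done.length + 2)) :
    mean (step v hα rule s) (fun s => ENNReal.ofReal (expDev v α i lam κ s.done *
        epochFactor v α i lam κ (s.done.length + 1) s.current))
      ≤ ENNReal.ofReal (expDev v α i lam κ s.done *
        epochFactor v α i lam κ (s.done.length + 1) s.current) := by
  have hV : 0 ≤ ∑ j ∈ s.current.offered, v j := Finset.sum_nonneg fun i _ => (hv i).1.le
  refine (mean_step_le (fun i => (hv i).1.le) hα rule s (expDev_pos _).le
    (fun j => mul_nonneg (expDev_pos _).le (epochFactor_nonneg hv hadm _))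
    (mean_startEpoch_le hv hα rule _ hadm') fun j => le_rfl).trans (le_of_eq ?_)
  congr 1
  rw [div_eq_iff (by linarith), mul_comm]
  exact epochFactor_step hv s.done s.current hadm

/-- The next step ends the epoch with probability at least `1 / (N + 1)`. -/
theorem one_add_sum_le (hv : ∀ i, 0 < v i ∧ v i ≤ 1) (S : Finset (Fin N)) :
    1 + ∑ j ∈ S, v j ≤ N + 1 := by
  have h1 : ∑ j ∈ S, v j ≤ ∑ j ∈ S, (1 : ℝ) := Finset.sum_le_sum fun j _ => (hv j).2
  have h2 : (S.card : ℝ) ≤ N := by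
    exact_mod_cast (Finset.card_le_univ S).trans_eq (Fintype.card_fin N)
  simp only [Finset.sum_const, nsmul_eq_mul, mul_one] at h1
  linarith

theorem mean_start_done {f : History N → ℝ≥0∞} (hα : 0 ≤ α)
    (rule : History N → Finset (Fin N)) (h : History N) :
    mean (startEpoch hα rule h) (fun s => f s.done) = f h := by
  rw [startEpoch, mean_map, mean]
  simp only [Function.comp_apply]
  rw [ENNReal.tsum_mul_right, PMF.tsum_coe, one_mul]

theorem mean_step_expDev_le (hv : ∀ i, 0 < v i ∧ v i ≤ 1) (hα : 0 ≤ α)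
    (rule : History N → Finset (Fin N)) (s : State N)
    (hadm : Admissible α i lam κ (s.done.length + 1)) :
    mean (step v hα rule s) (fun s => ENNReal.ofReal (expDev v α i lam κ s.done))
      ≤ ENNReal.ofReal (N / (N + 1)) * ENNReal.ofReal (expDev v α i lam κ s.done)
        + ENNReal.ofReal (expDev v α i lam κ s.done *
          epochFactor v α i lam κ (s.done.length + 1) s.current) := by
  have hV : 0 ≤ ∑ j ∈ s.current.offered, v j := Finset.sum_nonneg fun i _ => (hv i).1.le
  have hN := one_add_sum_le hv s.current.offered
  have hA := expDev_pos (v := v) (α := α) (i := i) (lam := lam) (κ := κ) s.done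
  have hZ : ∀ e, 0 ≤ expDev v α i lam κ s.done * epochFactor v α i lam κ (s.done.length + 1) e :=
    fun e => mul_nonneg hA.le (epochFactor_nonneg hv hadm _)
  refine (mean_step_le (fun i => (hv i).1.le) hα rule s (expDev_pos (s.current :: s.done)).le
    (fun _ => hA.le)
    (mean_start_done (f := fun h => ENNReal.ofReal (expDev v α i lam κ h)) hα rule _).le fun j => le_rfl).trans ?_
  rw [← ENNReal.ofReal_mul (by positivity), ← ENNReal.ofReal_add (by positivity) (hZ _)]
  refine ENNReal.ofReal_le_ofReal ?_
  rw [add_div, add_comm]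
  refine add_le_add ?_ ?_
  · rw [← Finset.sum_mul, mul_div_right_comm]
    refine mul_le_mul_of_nonneg_right ?_ hA.le
    rw [div_le_div_iff₀ (by linarith) (by positivity)]
    nlinarith
  · rw [div_le_iff₀ (by linarith), mul_comm, ← epochFactor_step hv s.done s.current hadm]
    exact le_add_of_nonneg_right
      (Finset.sum_nonneg fun j _ => mul_nonneg (hv j).1.le (hZ _))

theorem mean_runLaw_supermartingale_le (hv : ∀ i, 0 < v i ∧ v i ≤ 1) (hα : 0 ≤ α)
    (rule : History N → Finset (Fin N)) (n : ℕ)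
    (hadm : ∀ l, 1 ≤ l → l ≤ n + 1 → Admissible α i lam κ l) :
    mean (runLaw v hα rule n) (fun s => ENNReal.ofReal (expDev v α i lam κ s.done *
        epochFactor v α i lam κ (s.done.length + 1) s.current)) ≤ 1 := by
  induction n with
  | zero =>
    refine (mean_startEpoch_le hv hα rule [] (hadm _ le_rfl le_rfl)).trans_eq ?_
    simp [expDev, sumV]
  | succ n ih =>
    rw [runLaw, mean_bind]
    refine (mean_le_mean fun s hs => ?_).trans (ih fun l h1 h2 => hadm l h1 (by omega))
    have := length_done_le_of_mem_support hα rule n s hs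
    exact mean_step_supermartingale_le hv hα rule s (hadm _ (by omega) (by omega))
      (hadm _ (by omega) (by omega))

/-- At a fixed time an epoch is running, so `expDev` of the completed epochs is not itself bounded
by the supermartingale. Its expectation gains, at each step, at most the expectation of the
supermartingale, and keeps at most a fraction `N / (N + 1)` of its previous value; the geometric
series sums to `N + 1`. -/
theorem mean_runLaw_expDev_le (hv : ∀ i, 0 < v i ∧ v i ≤ 1) (hα : 0 ≤ α)
    (rule : History N → Finset (Fin N)) (n : ℕ)
    (hadm : ∀ l, 1 ≤ l → l ≤ n + 1 → Admissible α i lam κ l) :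
    mean (runLaw v hα rule n) (fun s => ENNReal.ofReal (expDev v α i lam κ s.done))
      ≤ ENNReal.ofReal (N + 1) := by
  induction n with
  | zero =>
    rw [runLaw, mean_start_done hα rule (f := fun h => ENNReal.ofReal (expDev v α i lam κ h))]
    refine ENNReal.ofReal_le_ofReal ?_
    simp [expDev, sumV]
  | succ n ih =>
    have hadm' : ∀ l, 1 ≤ l → l ≤ n + 1 → Admissible α i lam κ l :=
      fun l h1 h2 => hadm l h1 (by omega)
    rw [runLaw, mean_bind]
    refine (mean_le_mean fun s hs => mean_step_expDev_le hv hα rule s ?_).trans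
      ((mean_add _ _ _).le.trans ((add_le_add
        ((mean_const_mul _ _ _).le.trans (mul_le_mul_right (ih hadm') _))
        (mean_runLaw_supermartingale_le hv hα rule n hadm')).trans_eq ?_))
    · have := length_done_le_of_mem_support hα rule n s hs
      exact hadm _ (by omega) (by omega)
    · rw [← ENNReal.ofReal_mul (by positivity), ← ENNReal.ofReal_one,
        ← ENNReal.ofReal_add (by positivity) zero_le_one]
      congr 1
      field_simp

/-! ### The number of completed epochs -/

/-- Each step completes an epoch with probability at least `1 / (N + 1)`, hence multiplies the
expectation of `(1 / 2) ^ L` by at most `1 - 1 / (2 (N + 1))`. -/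
theorem mean_runLaw_half_pow_le (hv : ∀ i, 0 < v i ∧ v i ≤ 1) (hα : 0 ≤ α)
    (rule : History N → Finset (Fin N)) (n : ℕ) :
    mean (runLaw v hα rule n) (fun s => ENNReal.ofReal ((1 / 2) ^ s.done.length))
      ≤ ENNReal.ofReal ((1 - 1 / (2 * (N + 1))) ^ n) := by
  have hρ : (0 : ℝ) ≤ 1 - 1 / (2 * (N + 1)) := by
    rw [sub_nonneg, div_le_one (by positivity)]
    linarith [Nat.cast_nonneg (α := ℝ) N]
  induction n with
  | zero =>
    rw [runLaw, mean_start_done hα rule (f := fun h => ENNReal.ofReal ((1 / 2) ^ h.length))]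
    simp
  | succ n ih =>
    rw [runLaw, mean_bind, pow_succ', ENNReal.ofReal_mul hρ]
    refine (mean_le_mean fun s _ => ?_).trans
      ((mean_const_mul _ _ _).le.trans (mul_le_mul_right ih _))
    have hV : 0 ≤ ∑ j ∈ s.current.offered, v j := Finset.sum_nonneg fun i _ => (hv i).1.le
    have hN := one_add_sum_le hv s.current.offered
    refine (mean_step_le (fun i => (hv i).1.le) hα rule s
      (a := (1 / 2) ^ (s.current :: s.done).length) (b := fun _ => (1 / 2) ^ s.done.length)
      (by positivity) (fun _ => by positivity)
      (mean_start_done hα rule (f := fun h => ENNReal.ofReal ((1 / 2) ^ h.length)) _).le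
      fun j => le_rfl).trans ?_
    rw [← ENNReal.ofReal_mul hρ]
    refine ENNReal.ofReal_le_ofReal ?_
    rw [← Finset.sum_mul, List.length_cons, pow_succ', ← add_mul, mul_div_right_comm]
    refine mul_le_mul_of_nonneg_right ?_ (by positivity)
    rw [div_le_iff₀ (by linarith)]
    have : 1 / (2 * ((N : ℝ) + 1)) * (1 + ∑ j ∈ s.current.offered, v j) ≤ 1 / 2 := by
      rw [one_div_mul_eq_div, div_le_iff₀ (by positivity)]
      linarith
    linarith

end Supermartingale

/-! ### Deviation of the estimated attraction parameters -/

theorem exploreProb_bounds {α : ℝ} (hα : 0 ≤ α) {l T : ℕ} (hl : 1 ≤ l) (hlT : l ≤ T) :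
    1 / (2 * (T : ℝ) ^ α) ≤ exploreProb α l ∧ exploreProb α l ≤ 1 / 2 := by
  have hl' : (1 : ℝ) ≤ l := by exact_mod_cast hl
  have h1 : (1 : ℝ) ≤ (l : ℝ) ^ α := one_le_rpow hl' hα
  have h2 : (l : ℝ) ^ α ≤ (T : ℝ) ^ α :=
    rpow_le_rpow (by linarith) (by exact_mod_cast hlT) hα
  unfold exploreProb
  constructor
  · gcongr
  · gcongr
    linarith

theorem inclusionProb_bounds {N : ℕ} {α : ℝ} (hα : 0 ≤ α) {l T : ℕ} (hl : 1 ≤ l) (hlT : l ≤ T)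
    (star : Finset (Fin N)) (i : Fin N) :
    1 / (2 * (T : ℝ) ^ α) ≤ inclusionProb α l star i ∧ inclusionProb α l star i ≤ 1 := by
  have h := exploreProb_bounds hα hl hlT
  have hT : (1 : ℝ) ≤ (T : ℝ) ^ α := one_le_rpow (by exact_mod_cast hl.trans hlT) hα
  have h0 : 0 ≤ 1 / (2 * (T : ℝ) ^ α) := by positivity
  unfold inclusionProb
  split_ifs <;> constructor <;> linarith

theorem admissible_of_abs_le {N : ℕ} {α : ℝ} (hα : 0 ≤ α) {l T : ℕ} (hl : 1 ≤ l) (hlT : l ≤ T)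
    (i : Fin N) {lam : ℝ} (hlam : |lam| * (T : ℝ) ^ α ≤ 1 / 8) :
    Admissible α i lam (9 * lam ^ 2 * (T : ℝ) ^ α) l := by
  intro star
  obtain ⟨h1, h2⟩ := inclusionProb_bounds hα hl hlT star i
  have hT : (1 : ℝ) ≤ (T : ℝ) ^ α := one_le_rpow (by exact_mod_cast hl.trans hlT) hα
  have hp : 0 < inclusionProb α l star i := lt_of_lt_of_le (by positivity) h1
  have hpT : 1 ≤ inclusionProb α l star i * (2 * (T : ℝ) ^ α) := (div_le_iff₀ (by linarith)).1 h1
  refine ⟨hp, h2, ?_, ?_⟩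
  · rw [abs_div, abs_of_pos hp, div_le_iff₀ hp]
    nlinarith [abs_nonneg lam]
  · rw [← mul_div_assoc, div_le_iff₀ hp]
    nlinarith [mul_le_mul_of_nonneg_left hpT (sq_nonneg lam)]

theorem sumV_nonneg {N : ℕ} {α : ℝ} (hα : 0 ≤ α) (h : History N) (i : Fin N) :
    0 ≤ sumV α h i := by
  induction h with
  | nil => exact le_rfl
  | cons e h ih =>
    refine add_nonneg ih ?_
    have := (inclusionProb_bounds hα (Nat.succ_pos h.length) le_rfl e.star i).1
    have hp : 0 ≤ inclusionProb α (h.length + 1) e.star i := le_trans (by positivity) this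
    split_ifs
    · positivity
    · exact le_rfl

theorem vHat_nonneg {N : ℕ} {α : ℝ} (hα : 0 ≤ α) (s : State N) (i : Fin N) : 0 ≤ vHat α s i :=
  div_nonneg (sumV_nonneg hα _ _) (Nat.cast_nonneg _)

/-- Bounds on `expDev` for the exponents `lam` and `-lam` control both signs of the deviation. -/
theorem abs_vHat_sub_le {N : ℕ} {v : Fin N → ℝ} {α : ℝ} {s : State N} {i : Fin N} {lam κ M : ℝ}
    (hL : 0 < s.done.length) (hlam : 0 < lam)
    (h1 : expDev v α i lam κ s.done ≤ exp M) (h2 : expDev v α i (-lam) κ s.done ≤ exp M) :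
    |vHat α s i - v i| ≤ κ / lam + M / (lam * s.done.length) := by
  have hL' : (0 : ℝ) < s.done.length := by exact_mod_cast hL
  have e1 := exp_le_exp.1 h1
  have e2 := exp_le_exp.1 h2
  have hv : vHat α s i - v i = (sumV α s.done i - v i * s.done.length) / s.done.length := by
    unfold vHat
    field_simp
  have hr : κ / lam + M / (lam * s.done.length)
      = ((κ * s.done.length + M) / lam) / s.done.length := by
    field_simp
  rw [hv, hr, abs_div, abs_of_pos hL']
  refine div_le_div_of_nonneg_right ?_ hL'.le
  have hmul : ∀ a : ℝ, |a| * lam = |a * lam| := fun a => by rw [abs_mul, abs_of_pos hlam]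
  rw [le_div_iff₀ hlam, hmul, abs_le]
  constructor <;> linarith

theorem mul_lt_one_of_ofReal {c a : ℝ} (hc : 0 ≤ c)
    (h : ENNReal.ofReal c * ENNReal.ofReal a < 1) : c * a < 1 := by
  rw [← ENNReal.ofReal_mul hc, ENNReal.ofReal_lt_one] at h
  exact h

theorem two_mul_mul_succ_le_four_pow (N : ℕ) : 2 * N * (N + 1) ≤ 4 ^ N := by
  induction N with
  | zero => simp
  | succ n ih =>
    rcases n with _ | n
    · simp
    · rw [pow_succ]
      nlinarith

/-- With `x ^ 2 = T ^ (α - 1)`, the regime in which the claimed bound is below `1` forces the time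
horizon to be large compared with the number of items and with `log (2 / δ)`. -/
theorem large_horizon {N : ℕ} (hN : 1 ≤ N) {D x y T : ℝ} (hD : 0.69 ≤ D) (hx : 0 < x) (hy : 1 ≤ y)
    (hxy : x ^ 2 * T = y) (hsmall : 12 * √2 * D * (2 * (N : ℝ) ^ 2 + N) * x < 1) :
    (N + 1) * x ≤ 1 / 8 ∧ 6 * (N + 1) * D + 3 ≤ T := by
  have hN' : (1 : ℝ) ≤ N := by exact_mod_cast hN
  have h2 : (1.4 : ℝ) ≤ √2 := le_sqrt_of_sq_le (by norm_num)
  have hquad : 3 / 2 * ((N : ℝ) + 1) ≤ 2 * (N : ℝ) ^ 2 + N := by nlinarith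
  have hbound : 25 * (D * ((N + 1) * x)) < 1 := by
    refine lt_of_le_of_lt ?_ hsmall
    calc 25 * (D * ((N + 1) * x)) ≤ 12 * 1.4 * D * (3 / 2 * ((N : ℝ) + 1)) * x := by
          have : 0 ≤ D * ((N + 1) * x) := by positivity
          nlinarith
      _ ≤ 12 * √2 * D * (2 * (N : ℝ) ^ 2 + N) * x := by gcongr
  have hNx : 0 < ((N : ℝ) + 1) * x := by positivity
  have hNx' : 17 * (((N : ℝ) + 1) * x) < 1 := by nlinarith
  refine ⟨by linarith, ?_⟩
  have hxle : 34 * x < 1 := by nlinarith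
  have hxx : (6 * ((N : ℝ) + 1) * D + 3) * x ^ 2 ≤ 1 := by
    have h3 : (6 * ((N : ℝ) + 1) * D + 3) * x ^ 2 = 6 * (D * ((N + 1) * x)) * x + 3 * x * x := by
      ring
    rw [h3]
    nlinarith
  have : (6 * ((N : ℝ) + 1) * D + 3) * x ^ 2 ≤ T * x ^ 2 := by linarith
  exact le_of_mul_le_mul_right this (by positivity)

/-- Markov's level `4 N (N + 1) / δ` is absorbed into a power of `2 / δ`. -/
theorem le_exp_of_mul_lt_one {N : ℕ} (hN : 1 ≤ N) {δ a : ℝ} (hδ0 : 0 < δ) (hδ1 : δ < 1)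
    (ha : δ / (4 * N * (N + 1)) * a < 1) : a ≤ exp ((2 * N + 1) * log (2 / δ)) := by
  have hN' : (1 : ℝ) ≤ N := by exact_mod_cast hN
  have h2 : 2 ≤ 2 / δ := by
    rw [le_div_iff₀ hδ0]
    linarith
  have hpow : exp ((2 * N + 1) * log (2 / δ)) = (2 / δ) ^ (2 * N + 1) := by
    rw [← exp_log (show (0 : ℝ) < 2 / δ by positivity), ← exp_nat_mul, log_exp]
    push_cast
    rfl
  have h4 : (2 * N * (N + 1) : ℝ) ≤ 4 ^ N := by exact_mod_cast two_mul_mul_succ_le_four_pow N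
  have h5 : (4 : ℝ) ^ N ≤ (2 / δ) ^ (2 * N) := by
    rw [pow_mul]
    gcongr
    nlinarith
  have h6 : a ≤ 2 * N * (N + 1) * (2 / δ) := by
    rw [div_mul_eq_mul_div, div_lt_one (by positivity)] at ha
    rw [← mul_div_assoc, le_div_iff₀ hδ0]
    linarith
  rw [hpow, pow_succ]
  exact h6.trans (mul_le_mul_of_nonneg_right (h4.trans h5) (by positivity))

theorem le_length_of_half_pow_lt {N T L : ℕ} {D : ℝ} (hT : 1 ≤ T)
    (h : (1 / 2 : ℝ) ^ L < exp D * (1 - 1 / (2 * ((N : ℝ) + 1))) ^ (T - 1))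
    (hTlarge : 6 * (N + 1) * D + 3 ≤ (T : ℝ)) : T / (3 * (N + 1)) ≤ (L : ℝ) := by
  have hN : (0 : ℝ) < N + 1 := by positivity
  have hn : ((T - 1 : ℕ) : ℝ) = T - 1 := by push_cast [hT]; ring
  have h1 : exp (-(L : ℝ)) ≤ (1 / 2) ^ L := by
    rw [← mul_neg_one, exp_nat_mul]
    gcongr
    rw [exp_neg, ← one_div]
    gcongr
    linarith [add_one_le_exp (1 : ℝ)]
  have hρ : 0 ≤ 1 - 1 / (2 * ((N : ℝ) + 1)) := by
    rw [sub_nonneg, div_le_one (by positivity)]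
    linarith [Nat.cast_nonneg (α := ℝ) N]
  have h2 : (1 - 1 / (2 * ((N : ℝ) + 1))) ^ (T - 1) ≤ exp (-((T - 1) / (2 * (N + 1)))) := by
    have h3 : 1 - 1 / (2 * ((N : ℝ) + 1)) ≤ exp (-(1 / (2 * (N + 1)))) := by
      linarith [add_one_le_exp (-(1 / (2 * ((N : ℝ) + 1))))]
    refine (pow_le_pow_left₀ hρ h3 _).trans_eq ?_
    rw [← exp_nat_mul, hn]
    congr 1
    ring
  have h4 : exp (-(L : ℝ)) < exp (D + -((T - 1) / (2 * (N + 1)))) := by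
    rw [exp_add]
    exact (h1.trans_lt h).trans_le (mul_le_mul_of_nonneg_left h2 (exp_pos _).le)
  have h5 := exp_lt_exp.1 h4
  have h6 : T / (3 * ((N : ℝ) + 1)) ≤ (T - 1) / (2 * (N + 1)) - D := by
    have h7 : ((T : ℝ) - 1) / (2 * (N + 1)) - D - T / (3 * ((N : ℝ) + 1))
        = (T - (6 * (N + 1) * D + 3)) / (6 * (N + 1)) := by
      field_simp
      ring
    have h8 : 0 ≤ ((T : ℝ) - (6 * (N + 1) * D + 3)) / (6 * (N + 1)) :=
      div_nonneg (by linarith) (by linarith)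
    linarith
  linarith

/-- The two terms of `abs_vHat_sub_le` with exponent `lam = (N + 1) x / y` and penalty
`κ = 9 lam ^ 2 y`, when at least `T / (3 (N + 1))` epochs have been completed. -/
theorem deviation_rate_le {N : ℕ} (hN : 1 ≤ N) {D x y T L : ℝ} (hD : 0.69 ≤ D) (hx : 0 < x)
    (hy : 0 < y) (hxy : x ^ 2 * T = y) (hT : 1 ≤ T) (hL : T / (3 * (N + 1)) ≤ L) :
    9 * ((N + 1) * x / y) ^ 2 * y / ((N + 1) * x / y)
        + (2 * N + 1) * D / ((N + 1) * x / y * L)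
      ≤ 12 * √2 * D * (2 * N + 1) * x := by
  have hN' : (1 : ℝ) ≤ N := by exact_mod_cast hN
  have hκ : 9 * (((N : ℝ) + 1) * x / y) ^ 2 * y / ((N + 1) * x / y) = 9 * (N + 1) * x := by
    field_simp
  have hlamL : 1 / (3 * x) ≤ (N + 1) * x / y * L := by
    refine le_trans (le_of_eq ?_) (mul_le_mul_of_nonneg_left hL (by positivity))
    rw [← hxy]
    field_simp
  have hM : (2 * N + 1) * D / ((N + 1) * x / y * L) ≤ 3 * (2 * N + 1) * D * x := by
    refine (div_le_div_of_nonneg_left (by positivity) (by positivity) hlamL).trans_eq ?_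
    field_simp
  have h2 : (1.4 : ℝ) ≤ √2 := le_sqrt_of_sq_le (by norm_num)
  have hcoef : 9 * ((N : ℝ) + 1) + 3 * (2 * N + 1) * D ≤ 12 * √2 * D * (2 * N + 1) :=
    calc 9 * ((N : ℝ) + 1) + 3 * (2 * N + 1) * D ≤ 6 * (2 * N + 1) + 3 * (2 * N + 1) * D := by
          linarith
      _ ≤ 12 * 1.4 * D * (2 * N + 1) := by nlinarith
      _ ≤ 12 * √2 * D * (2 * N + 1) := by gcongr
  rw [hκ]
  linarith [mul_le_mul_of_nonneg_right hcoef hx.le]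

section Deviation

variable {N : ℕ} {v : Fin N → ℝ} {α : ℝ}

/-- A union bound over the items, both signs of the deviation and the event that few epochs are
completed, organised as one application of Markov's inequality. -/
theorem toMeasure_deviation_le (hN : 1 ≤ N) (hv : ∀ i, 0 < v i ∧ v i ≤ 1) (hα : 0 ≤ α)
    (rule : History N → Finset (Fin N)) {T : ℕ} (hT : 1 ≤ T) {δ : ℝ} (hδ0 : 0 < δ) (hδ1 : δ < 1)
    (hsmall : 12 * √2 * log (2 / δ) * (2 * (N : ℝ) ^ 2 + N) * √((T : ℝ) ^ (α - 1)) < 1) :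
    outcome v hα rule T {s | ¬ ∀ i, |vHat α s i - v i|
        ≤ 12 * √2 * log (2 / δ) * (2 * N + 1) * √((T : ℝ) ^ (α - 1))} ≤ ENNReal.ofReal δ := by
  have hN' : (1 : ℝ) ≤ N := by exact_mod_cast hN
  have hT' : (1 : ℝ) ≤ T := by exact_mod_cast hT
  set D := log (2 / δ) with hDdef
  set x := √((T : ℝ) ^ (α - 1)) with hxdef
  set y := (T : ℝ) ^ α with hydef
  have hexpD : exp D = 2 / δ := exp_log (by positivity)
  have h2D : 2 ≤ exp D := by
    rw [hexpD, le_div_iff₀ hδ0]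
    linarith
  have hD : 0.69 ≤ D := by
    have h1 := log_le_log two_pos h2D
    rw [log_exp] at h1
    linarith [log_two_gt_d9]
  have hx : 0 < x := sqrt_pos.2 (rpow_pos_of_pos (by linarith) _)
  have hy : 1 ≤ y := one_le_rpow hT' hα
  have hxy : x ^ 2 * T = y := by
    rw [hxdef, sq_sqrt (rpow_nonneg (by linarith) _), hydef, rpow_sub_one (by linarith)]
    field_simp
  obtain ⟨hNx, hTlarge⟩ := large_horizon hN hD hx hy hxy hsmall
  -- The exponent that balances the two terms of the deviation bound, up to a constant.
  set lam := (N + 1) * x / y with hlamdef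
  set κ := 9 * lam ^ 2 * y with hκdef
  have hlam : 0 < lam := by positivity
  have hlamy : lam * y = (N + 1) * x := by
    rw [hlamdef]
    field_simp
  have hadm : ∀ (i : Fin N) (l : ℕ), 1 ≤ l → l ≤ T - 1 + 1 →
      Admissible α i lam κ l ∧ Admissible α i (-lam) κ l := by
    intro i l h1 h2
    have h3 : l ≤ T := by omega
    refine ⟨admissible_of_abs_le hα h1 h3 i ?_, ?_⟩
    · rw [abs_of_pos hlam, ← hydef, hlamy]
      exact hNx
    · rw [hκdef, ← neg_sq lam]
      refine admissible_of_abs_le hα h1 h3 i ?_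
      rw [abs_neg, abs_of_pos hlam, ← hydef, hlamy]
      exact hNx
  set ρ : ℝ := 1 - 1 / (2 * (N + 1)) with hρdef
  have hρ : 0 < ρ := by
    rw [hρdef, sub_pos, div_lt_one (by positivity)]
    linarith
  set c₁ := δ / (4 * N * (N + 1)) with hc₁
  set c₂ := δ / 2 / ρ ^ (T - 1) with hc₂
  have hc₁pos : 0 < c₁ := by positivity
  have hc₂pos : 0 < c₂ := by positivity
  set F : State N → ℝ≥0∞ := fun s =>
    ∑ i, (ENNReal.ofReal c₁ * ENNReal.ofReal (expDev v α i lam κ s.done)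
      + ENNReal.ofReal c₁ * ENNReal.ofReal (expDev v α i (-lam) κ s.done))
    + ENNReal.ofReal c₂ * ENNReal.ofReal ((1 / 2) ^ s.done.length) with hF
  have hmeanF : mean (runLaw v hα rule (T - 1)) F ≤ ENNReal.ofReal δ := by
    have hterm : ∀ i ∈ (Finset.univ : Finset (Fin N)), mean (runLaw v hα rule (T - 1)) (fun s =>
        ENNReal.ofReal c₁ * ENNReal.ofReal (expDev v α i lam κ s.done)
          + ENNReal.ofReal c₁ * ENNReal.ofReal (expDev v α i (-lam) κ s.done))
        ≤ ENNReal.ofReal (δ / (2 * N)) := by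
      intro i _
      rw [mean_add, mean_const_mul, mean_const_mul]
      refine (add_le_add
        (mul_le_mul_right (mean_runLaw_expDev_le hv hα rule _ fun l h1 h2 => (hadm i l h1 h2).1) _)
        (mul_le_mul_right (mean_runLaw_expDev_le hv hα rule _ fun l h1 h2 => (hadm i l h1 h2).2)
          _)).trans_eq ?_
      rw [← ENNReal.ofReal_mul hc₁pos.le, ← ENNReal.ofReal_add (by positivity) (by positivity)]
      congr 1
      rw [hc₁]
      field_simp
      ring
    rw [hF, mean_add, mean_finset_sum, mean_const_mul]
    refine (add_le_add (Finset.sum_le_sum hterm)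
      (mul_le_mul_right (mean_runLaw_half_pow_le hv hα rule _) _)).trans_eq ?_
    rw [Finset.sum_const, Finset.card_univ, Fintype.card_fin, nsmul_eq_mul,
      ← ENNReal.ofReal_natCast, ← ENNReal.ofReal_mul (by positivity),
      ← ENNReal.ofReal_mul hc₂pos.le, ← hρdef,
      ← ENNReal.ofReal_add (by positivity) (by positivity)]
    congr 1
    rw [hc₂]
    field_simp
    ring
  refine (measure_mono ?_).trans ((toMeasure_one_le_le_mean _ F).trans hmeanF)
  intro s hs
  by_contra hlt
  replace hlt : F s < 1 := not_le.1 hlt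
  refine hs fun i => ?_
  have hsum_lt := lt_of_le_of_lt le_self_add hlt
  have hi_lt := lt_of_le_of_lt (Finset.single_le_sum (f := fun i =>
    ENNReal.ofReal c₁ * ENNReal.ofReal (expDev v α i lam κ s.done)
      + ENNReal.ofReal c₁ * ENNReal.ofReal (expDev v α i (-lam) κ s.done))
    (fun _ _ => zero_le) (Finset.mem_univ i)) hsum_lt
  have hplus := le_exp_of_mul_lt_one hN hδ0 hδ1 (mul_lt_one_of_ofReal hc₁pos.le (lt_of_le_of_lt le_self_add hi_lt))
  have hminus := le_exp_of_mul_lt_one hN hδ0 hδ1 (mul_lt_one_of_ofReal hc₁pos.le (lt_of_le_of_lt le_add_self hi_lt))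
  have hepochs := mul_lt_one_of_ofReal hc₂pos.le (lt_of_le_of_lt le_add_self hlt)
  have hL : T / (3 * (N + 1)) ≤ (s.done.length : ℝ) := by
    refine le_length_of_half_pow_lt hT ?_ hTlarge
    have h1 : c₂ = 1 / (exp D * ρ ^ (T - 1)) := by
      rw [hc₂, hexpD]
      field_simp
    rwa [h1, one_div_mul_eq_div, div_lt_one (by positivity)] at hepochs
  have hTN : 0 < (T : ℝ) / (3 * (N + 1)) := by positivity
  have hLpos : 0 < s.done.length := by exact_mod_cast hTN.trans_le hL
  refine (abs_vHat_sub_le hLpos hlam hplus hminus).trans ?_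
  exact deviation_rate_le hN hD hx (zero_lt_one.trans_le hy) hxy hT' hL

instance isProbabilityMeasure_outcome (hα : 0 ≤ α) (rule : History N → Finset (Fin N)) (T : ℕ) :
    IsProbabilityMeasure (outcome v hα rule T) :=
  PMF.toMeasure.isProbabilityMeasure _

/-- The uniform high-probability bound on the revenue error, with the rate `√(T ^ (α - 1))`. -/
theorem toMeasure_revenue_deviation_le {r : Fin N → ℝ} (hv : ∀ i, 0 < v i ∧ v i ≤ 1)
    (hr : ∀ i, 0 ≤ r i ∧ r i ≤ 1) (hα : 0 ≤ α) (rule : History N → Finset (Fin N)) {T : ℕ}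
    (hT : 1 ≤ T) {δ : ℝ} (hδ0 : 0 < δ) (hδ1 : δ < 1) :
    outcome v hα rule T {s | ¬ ∀ S, |revenueHat r α s S - revenue r v S|
        ≤ 12 * √2 * log (2 / δ) * (2 * (N : ℝ) ^ 2 + N) * √((T : ℝ) ^ (α - 1))}
      ≤ ENNReal.ofReal δ := by
  have hv0 : ∀ i, 0 ≤ v i := fun i => (hv i).1.le
  have hD : 0 ≤ log (2 / δ) := log_nonneg (by rw [le_div_iff₀ hδ0]; linarith)
  rcases le_or_gt 1 (12 * √2 * log (2 / δ) * (2 * (N : ℝ) ^ 2 + N) * √((T : ℝ) ^ (α - 1)))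
    with hlarge | hsmall
  · refine (measure_mono_null (t := ∅) ?_ measure_empty).trans_le zero_le
    intro s hs
    exact hs fun S => (abs_revenue_sub_le_one hr (vHat_nonneg hα s) hv0 S).trans hlarge
  · rcases Nat.eq_zero_or_pos N with rfl | hN
    · refine (measure_mono_null (t := ∅) ?_ measure_empty).trans_le zero_le
      intro s hs
      refine hs fun S => (abs_revenue_sub_le_sum hr (vHat_nonneg hα s) hv0 S).trans ?_
      simp [Finset.eq_empty_of_isEmpty S]
    · refine (measure_mono ?_).trans (toMeasure_deviation_le hN hv hα rule hT hδ0 hδ1 hsmall)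
      intro s hs hgood
      refine hs fun S => ?_
      refine (abs_revenue_sub_le_sum hr (vHat_nonneg hα s) hv0 S).trans
        ((Finset.sum_le_sum fun i _ => hgood i).trans ?_)
      rw [Finset.sum_const, nsmul_eq_mul]
      have hcard : (S.card : ℝ) ≤ N := by
        exact_mod_cast (Finset.card_le_univ S).trans_eq (Fintype.card_fin N)
      refine (mul_le_mul_of_nonneg_right hcard (by positivity)).trans_eq ?_
      ring

/-- Integration of the exponential tail bound. -/
theorem lintegral_revenue_deviation_le {r : Fin N → ℝ} (hv : ∀ i, 0 < v i ∧ v i ≤ 1)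
    (hr : ∀ i, 0 ≤ r i ∧ r i ≤ 1) (hα : 0 ≤ α) (rule : History N → Finset (Fin N)) {T : ℕ}
    (hT : 1 ≤ T) (S : Finset (Fin N)) :
    ∫⁻ s, ENNReal.ofReal |revenueHat r α s S - revenue r v S| ∂(outcome v hα rule T)
      ≤ ENNReal.ofReal (2 * (12 * √2 * (2 * (N : ℝ) ^ 2 + N) + 1) * √((T : ℝ) ^ (α - 1))) := by
  have hT' : (0 : ℝ) < T := by exact_mod_cast hT
  have hx : 0 < √((T : ℝ) ^ (α - 1)) := sqrt_pos.2 (rpow_pos_of_pos hT' _)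
  -- The summand `1` keeps the scale positive when there are no items.
  set c := (12 * √2 * (2 * (N : ℝ) ^ 2 + N) + 1) * √((T : ℝ) ^ (α - 1)) with hc
  have hcpos : 0 < c := by positivity
  have hmeas : ∀ f : State N → ℝ, Measurable f := fun f _ _ => MeasurableSpace.measurableSet_top
  have htail : ∀ t : ℝ, 0 < t → outcome v hα rule T
      {s | t < |revenueHat r α s S - revenue r v S| / c} ≤ ENNReal.ofReal (2 * exp (-t)) := by
    intro t ht
    rcases le_or_gt 1 (2 * exp (-t)) with h1 | h1
    · exact prob_le_one.trans (by rwa [ENNReal.one_le_ofReal])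
    · refine (measure_mono ?_).trans
        (toMeasure_revenue_deviation_le hv hr hα rule hT (by positivity) h1)
      intro s hs hgood
      have hlog : log (2 / (2 * exp (-t))) = t := by
        rw [div_mul_cancel_left₀ two_ne_zero, ← exp_neg, neg_neg, log_exp]
      have h2 := hgood S
      rw [hlog] at h2
      have h3 := (lt_div_iff₀ hcpos).1 hs
      rw [hc] at h3
      nlinarith [mul_pos ht hx]
  have hscale : ∀ s : State N, ENNReal.ofReal |revenueHat r α s S - revenue r v S|
      = ENNReal.ofReal c * ENNReal.ofReal (|revenueHat r α s S - revenue r v S| / c) := by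
    intro s
    rw [← ENNReal.ofReal_mul hcpos.le, mul_div_cancel₀ _ hcpos.ne']
  simp only [hscale]
  rw [lintegral_const_mul _ (hmeas _).ennreal_ofReal, mul_assoc, ← hc, mul_comm 2,
    ENNReal.ofReal_mul hcpos.le]
  refine mul_le_mul_right ?_ _
  rw [lintegral_eq_lintegral_meas_lt _ (Filter.Eventually.of_forall fun s => by positivity)
    (hmeas _).aemeasurable]
  refine (setLIntegral_mono' measurableSet_Ioi fun t ht => htail t ht).trans_eq ?_
  rw [← ofReal_integral_eq_lintegral_ofReal ((integrableOn_exp_neg_Ioi 0).const_mul 2)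
    (Filter.Eventually.of_forall fun t => by positivity), integral_const_mul,
    integral_exp_neg_Ioi_zero, mul_one]

end Deviation

end MNLBandit

theorem theorem4p4 (N : ℕ) :
    ∃ C : ℝ, 0 < C ∧
      ∀ (v r : Fin N → ℝ) (_hv : ∀ i, 0 < v i ∧ v i ≤ 1) (_hr : ∀ i, 0 ≤ r i ∧ r i ≤ 1)
        (𝒮 : Finset (Finset (Fin N))) (_hsub : ∀ S ∈ 𝒮, ∀ Q ⊆ S, Q ∈ 𝒮)
        (α : ℝ) (hα0 : 0 ≤ α) (_hα1 : α ≤ 1 / 2)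
        (rule : MNLBandit.History N → Finset (Fin N))
        (_hrule : MNLBandit.IsOptimistic r 𝒮 rule)
        (T : ℕ) (_hT : 1 ≤ T),
        (∀ δ : ℝ, 0 < δ → δ < 1 →
          ENNReal.ofReal (1 - δ) ≤
            MNLBandit.outcome v hα0 rule T
              {s | ∀ S ∈ 𝒮,
                |MNLBandit.revenueHat r α s S - MNLBandit.revenue r v S| ≤
                  12 * √2 * Real.log (2 / δ) * (2 * (N : ℝ) ^ 2 + N) *
                    √(((N : ℝ) / T) ^ (1 - α))}) ∧
        (∀ S ∈ 𝒮,
          ∫⁻ s, ENNReal.ofReal |MNLBandit.revenueHat r α s S - MNLBandit.revenue r v S|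
              ∂(MNLBandit.outcome v hα0 rule T) ≤
            ENNReal.ofReal (C * √((T : ℝ) ^ (α - 1)))) := by
  refine ⟨2 * (12 * √2 * (2 * (N : ℝ) ^ 2 + N) + 1), by positivity, ?_⟩
  intro v r hv hr 𝒮 _ α hα0 hα1 rule _ T hT
  refine ⟨fun δ hδ0 hδ1 => ?_, fun S _ =>
    MNLBandit.lintegral_revenue_deviation_le hv hr hα0 rule hT S⟩
  have hT' : (1 : ℝ) ≤ T := by exact_mod_cast hT
  have hD : 0 ≤ Real.log (2 / δ) := Real.log_nonneg (by rw [le_div_iff₀ hδ0]; linarith)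
  have hrate : (2 * (N : ℝ) ^ 2 + N) * √((T : ℝ) ^ (α - 1))
      ≤ (2 * (N : ℝ) ^ 2 + N) * √(((N : ℝ) / T) ^ (1 - α)) := by
    rcases Nat.eq_zero_or_pos N with rfl | hN
    · simp
    · have hN' : (1 : ℝ) ≤ N := by exact_mod_cast hN
      refine mul_le_mul_of_nonneg_left (Real.sqrt_le_sqrt ?_) (by positivity)
      rw [← neg_sub 1 α, Real.rpow_neg (by linarith), ← Real.inv_rpow (by linarith), ← one_div]
      exact Real.rpow_le_rpow (by positivity) (by gcongr) (by linarith)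
  set good := {s | ∀ S ∈ 𝒮, |MNLBandit.revenueHat r α s S - MNLBandit.revenue r v S| ≤
    12 * √2 * Real.log (2 / δ) * (2 * (N : ℝ) ^ 2 + N) * √(((N : ℝ) / T) ^ (1 - α))} with hgood
  have hbad : MNLBandit.outcome v hα0 rule T goodᶜ ≤ ENNReal.ofReal δ := by
    refine (measure_mono ?_).trans
      (MNLBandit.toMeasure_revenue_deviation_le hv hr hα0 rule hT hδ0 hδ1)
    intro s hs h
    refine hs fun S _ => (h S).trans ?_
    rw [mul_assoc _ (2 * (N : ℝ) ^ 2 + N), mul_assoc _ (2 * (N : ℝ) ^ 2 + N)]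
    exact mul_le_mul_of_nonneg_left hrate (by positivity)
  rw [ENNReal.ofReal_sub _ hδ0.le, ENNReal.ofReal_one, tsub_le_iff_right]
  calc (1 : ℝ≥0∞) = MNLBandit.outcome v hα0 rule T Set.univ := measure_univ.symm
    _ ≤ MNLBandit.outcome v hα0 rule T good + MNLBandit.outcome v hα0 rule T goodᶜ := by
        rw [← Set.union_compl_self good]
        exact measure_union_le _ _
    _ ≤ _ := add_le_add_right hbad _
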